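/- All graphs are finite and simple. For a graph $H$ and $S\subseteq V(H)$, $H-S$ is the subgraph induced by $V(H)\setminus S$, and $N_H(u)$ is the set of neighbors of $u$. For an integer $r\ge 1$, the $r$-blowup $G^{(r)}$ of a graph $G$ is obtained by replacing each vertex $u$ of $G$ with an independent set $R_u$ of $r$ vertices and each edge $uw$ of $G$ with all edges between $R_u$ and $R_w$. *The $r$-fold game.* Color a set $B\subseteq V(G^{(r)})$ blue and all other vertices white, and repeatedly apply the following rule: if $B_t$ is the current set of blue vertices, $W$ is the vertex set of a connected component of $G^{(r)}-B_t$, $u\in B_t$ and $|N_{G^{(r)}}(u)\cap W|\le r$, then all vertices of $N_{G^{(r)}}(u)\cap W$ may be colored blue. The set $B$ is an $r$-fold PSD forcing set for $G$ if finitely many applications of the rule can turn all of $G^{(r)}$ blue. Let $Z^+_{[r]}(G)$ be the minimum cardinality of an $r$-fold PSD forcing set for $G$, and define the fractional PSD forcing number $$Z_f^+(G)=\inf_{r\ge 1}\frac{Z^+_{[r]}(G)}{r}.$$ *The three-color game.* Color each vertex of $G$ dark blue, light blue or white; let $\mathcal D$ and $\mathcal L$ be the (disjoint) sets of dark blue and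 of light blue vertices. Repeatedly apply the following rule: if $(\mathcal D_t,\mathcal L_t)$ is the current coloring, $W$ is the vertex set of a connected component of $G-\mathcal D_t$, $u\in \mathcal D_t\cup(\mathcal L_t\cap W)$, and $w\in W$ is the only light blue or white neighbor of $u$ in the subgraph of $G$ induced by $\mathcal D_t\cup W$, then $w$ may be colored dark blue. The pair $(\mathcal D,\mathcal L)$ is a fractional PSD forcing set for $G$ if finitely many applications of the rule can turn every vertex of $G$ dark blue. Let $\hat Z_f^+(G)$ be the minimum of $|\mathcal D|$ over all fractional PSD forcing sets $(\mathcal D,\mathcal L)$ for $G$. **Theorem.** For every graph $G$, $Z_f^+(G)=\hat Z_f^+(G)$. -/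

import Mathlib

namespace SimpleGraph

variable {V : Type*}

/-- The vertex set, inside `V`, of a connected component of `G - S`. -/
def compVerts (G : SimpleGraph V) (S : Set V) (C : (G.induce Sᶜ).ConnectedComponent) : Set V :=
  Subtype.val '' C.supp

/-- The `r`-blowup of `G`: every vertex `u` is replaced by the independent set `{u} × Fin r`, and
every edge by a complete bipartite graph. -/
def blowup (G : SimpleGraph V) (r : ℕ) : SimpleGraph (V × Fin r) where
  Adj p q := G.Adj p.1 q.1
  symm := ⟨fun _ _ h => SimpleGraph.Adj.symm h⟩
  loopless := ⟨fun _ h => h.ne rfl⟩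

/-- One force of the two-color PSD game on `H` in which at most `r` vertices are forced at once:
with `B` the set of blue vertices, a blue vertex `u` having at most `r` neighbors in a connected
component `C` of `H - B` turns all of these neighbors blue. -/
def RFoldPSDStep (H : SimpleGraph V) (r : ℕ) (B B' : Set V) : Prop :=
  ∃ u ∈ B, ∃ C : (H.induce Bᶜ).ConnectedComponent,
    (H.neighborSet u ∩ H.compVerts B C).ncard ≤ r ∧
      B' = B ∪ (H.neighborSet u ∩ H.compVerts B C)

/-- `B` is an `r`-fold PSD forcing set for `G`: starting from the blue set `B` in the `r`-blowup of
`G`, finitely many forces turn the whole blowup blue. -/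
def IsRFoldPSDForcingSet (G : SimpleGraph V) (r : ℕ) (B : Set (V × Fin r)) : Prop :=
  Relation.ReflTransGen ((G.blowup r).RFoldPSDStep r) B Set.univ

/-- The `r`-fold PSD forcing number: the minimum cardinality of an `r`-fold PSD forcing set. -/
noncomputable def rFoldPSDForcingNumber (G : SimpleGraph V) (r : ℕ) : ℕ :=
  sInf {k : ℕ | ∃ B : Set (V × Fin r), G.IsRFoldPSDForcingSet r B ∧ B.ncard = k}

/-- The fractional PSD forcing number: the infimum over `r ≥ 1` of the `r`-fold PSD forcing number
divided by `r`. -/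
noncomputable def fractionalPSDForcingNumber (G : SimpleGraph V) : ℝ :=
  ⨅ r : ℕ+, (G.rFoldPSDForcingNumber (r : ℕ) : ℝ) / ((r : ℕ) : ℝ)

/-- One force of the three-color game. A state is a pair `(D, L)` of the set of dark blue and the
set of light blue vertices; the other vertices are white. For a connected component `C` of `G - D`,
with vertex set `W`, a vertex `u` that is dark blue, or light blue and in `W`, turns `w ∈ W` dark
blue if `w` is the only light blue or white neighbor of `u` in the subgraph induced by `D ∪ W`. -/
def FracPSDStep (G : SimpleGraph V) (s s' : Set V × Set V) : Prop :=
  ∃ (C : (G.induce s.1ᶜ).ConnectedComponent) (u w : V),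
    u ∈ s.1 ∪ (s.2 ∩ G.compVerts s.1 C) ∧ w ∈ G.compVerts s.1 C ∧
      {v | v ∈ s.1 ∪ G.compVerts s.1 C ∧ G.Adj u v ∧ v ∉ s.1} = {w} ∧
        s' = (insert w s.1, s.2 \ {w})

/-- `(D, L)` is a (three-color) fractional PSD forcing set for `G`: the sets `D` (dark blue) and
`L` (light blue) are disjoint and finitely many forces turn every vertex dark blue. -/
def IsFracPSDForcingSet (G : SimpleGraph V) (D L : Set V) : Prop :=
  Disjoint D L ∧ Relation.ReflTransGen G.FracPSDStep (D, L) (Set.univ, ∅)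

/-- The three-color number: the minimum number of dark blue vertices in a fractional PSD forcing
set. -/
noncomputable def threeColorFracPSDForcingNumber (G : SimpleGraph V) : ℕ :=
  sInf {k : ℕ | ∃ D L : Set V, G.IsFracPSDForcingSet D L ∧ D.ncard = k}

/-- The set whose minimum defines the `r`-fold PSD forcing number is nonempty. -/
theorem rFoldPSD_nonempty (G : SimpleGraph V) (r : ℕ) :
    {k : ℕ | ∃ B : Set (V × Fin r), G.IsRFoldPSDForcingSet r B ∧ B.ncard = k}.Nonempty :=
  ⟨_, Set.univ, Relation.ReflTransGen.refl, rfl⟩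

/-- The set whose minimum defines the three-color number is nonempty. -/
theorem fracPSD_nonempty (G : SimpleGraph V) :
    {k : ℕ | ∃ D L : Set V, G.IsFracPSDForcingSet D L ∧ D.ncard = k}.Nonempty :=
  ⟨_, Set.univ, ∅, ⟨Set.disjoint_empty _, Relation.ReflTransGen.refl⟩, rfl⟩

end SimpleGraph

/-! ### Components of `G - S`. -/

namespace SimpleGraph

variable {V : Type*} {G : SimpleGraph V}

/-! Upper bound: given `(D, L)`, make blue all copies of `D` and one copy of each vertex of `L`. A
single blue copy is enough to force, so three-color forces can be simulated
(`isRFoldPSDForcingSet_of_fracPSD`). This costs at most `r * |D| + |V|`, and `|V| / r` tends to `0`.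

Lower bound, for every `r`: unwind an `r`-fold forcing sequence from its end. Completing all blocks
met by a force adds at most `r` vertices (`ncard_blocks_diff_le`). This pays for deleting one vertex
from the dark set, and a single three-color force restores it. Light vertices are free, so all
non-dark vertices are taken light. -/

theorem mem_compVerts_iff {S : Set V} {C : (G.induce Sᶜ).ConnectedComponent} {x : V} :
    x ∈ G.compVerts S C ↔ ∃ h : x ∈ Sᶜ, (G.induce Sᶜ).connectedComponentMk ⟨x, h⟩ = C := by
  simp [compVerts, ConnectedComponent.mem_supp_iff]

theorem notMem_of_mem_compVerts {S : Set V} {C : (G.induce Sᶜ).ConnectedComponent} {x : V}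
    (hx : x ∈ G.compVerts S C) : x ∉ S :=
  (mem_compVerts_iff.1 hx).1

theorem mem_compVerts_mk_iff {S : Set V} {x y : V} (hx : x ∈ Sᶜ) :
    y ∈ G.compVerts S ((G.induce Sᶜ).connectedComponentMk ⟨x, hx⟩) ↔
      ∃ hy : y ∈ Sᶜ, (G.induce Sᶜ).Reachable ⟨x, hx⟩ ⟨y, hy⟩ := by
  rw [mem_compVerts_iff]
  exact exists_congr fun hy => ConnectedComponent.eq.trans reachable_comm

theorem compVerts_eq_mk {S : Set V} {C : (G.induce Sᶜ).ConnectedComponent} {x : V}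
    (hx : x ∈ G.compVerts S C) :
    ∃ h : x ∈ Sᶜ, C = (G.induce Sᶜ).connectedComponentMk ⟨x, h⟩ :=
  let ⟨h, e⟩ := mem_compVerts_iff.1 hx
  ⟨h, e.symm⟩

theorem mem_compVerts_of_adj {S : Set V} {C : (G.induce Sᶜ).ConnectedComponent} {x y : V}
    (hx : x ∈ G.compVerts S C) (hy : y ∉ S) (h : G.Adj x y) : y ∈ G.compVerts S C := by
  obtain ⟨hxS, rfl⟩ := compVerts_eq_mk hx
  rw [mem_compVerts_mk_iff]
  exact ⟨hy, Adj.reachable (G := G.induce Sᶜ) (u := ⟨x, hxS⟩) (v := ⟨y, hy⟩) h⟩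

/-- A component with two vertices contains a neighbor of each of its vertices. -/
theorem exists_adj_of_mem_compVerts {S : Set V} {C : (G.induce Sᶜ).ConnectedComponent} {x y : V}
    (hx : x ∈ G.compVerts S C) (hy : y ∈ G.compVerts S C) (hne : x ≠ y) :
    ∃ z ∈ G.compVerts S C, G.Adj x z := by
  obtain ⟨hxS, rfl⟩ := compVerts_eq_mk hx
  obtain ⟨hyS, ⟨p⟩⟩ := (mem_compVerts_mk_iff hxS).1 hy
  cases p with
  | nil => exact absurd rfl hne
  | cons h _ => exact ⟨_, mem_compVerts_of_adj hx (Subtype.prop (p := (· ∈ Sᶜ)) _) h, h⟩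

section Blowup

variable {r : ℕ}

/-- The vertices of `G` all of whose copies in the blowup lie in `B`. -/
def fullVerts (B : Set (V × Fin r)) : Set V := {v | ∀ i, (v, i) ∈ B}

theorem fullVerts_mono {A B : Set (V × Fin r)} (h : A ⊆ B) : fullVerts A ⊆ fullVerts B :=
  fun _ hv i => h (hv i)

/-- A component of the blowup minus `B` projects into a component of `G - D`, if `B` contains all
copies of the vertices of `D`. -/
theorem fst_mem_compVerts {D : Set V} {B : Set (V × Fin r)} (hDB : D ⊆ fullVerts B)
    {C : (G.induce Dᶜ).ConnectedComponent} {C' : ((G.blowup r).induce Bᶜ).ConnectedComponent}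
    {p q : V × Fin r} (hp : p ∈ (G.blowup r).compVerts B C')
    (hq : q ∈ (G.blowup r).compVerts B C') (hpC : p.1 ∈ G.compVerts D C) :
    q.1 ∈ G.compVerts D C := by
  have hB : ∀ x : V × Fin r, x ∉ B → x.1 ∉ D := fun x hx hD => hx (hDB hD x.2)
  let f : (G.blowup r).induce Bᶜ →g G.induce Dᶜ :=
    ⟨fun x => ⟨x.1.1, hB x.1 x.2⟩, fun h => h⟩
  obtain ⟨hpB, rfl⟩ := compVerts_eq_mk hp
  obtain ⟨hpD, rfl⟩ := compVerts_eq_mk hpC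
  obtain ⟨hqB, hr⟩ := (mem_compVerts_mk_iff hpB).1 hq
  exact (mem_compVerts_mk_iff hpD).2 ⟨hB q hqB, hr.map f⟩

/-- A component of `G - D` lifts to a component of the blowup minus `B`, if `D` contains every
vertex all of whose copies are in `B`. -/
theorem exists_mem_compVerts_blowup {D : Set V} {B : Set (V × Fin r)} (hDB : fullVerts B ⊆ D)
    {C : (G.induce Dᶜ).ConnectedComponent} {C' : ((G.blowup r).induce Bᶜ).ConnectedComponent}
    {p : V × Fin r} {v : V} (hp : p ∈ (G.blowup r).compVerts B C')
    (hpC : p.1 ∈ G.compVerts D C) (hv : v ∈ G.compVerts D C) :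
    ∃ k, (v, k) ∈ (G.blowup r).compVerts B C' := by
  obtain ⟨hpD, rfl⟩ := compVerts_eq_mk hpC
  obtain ⟨hvD, hr⟩ := (mem_compVerts_mk_iff hpD).1 hv
  suffices H : ∀ y : ↥(Dᶜ), (G.induce Dᶜ).Reachable ⟨p.1, hpD⟩ y →
      ∃ k, (y.1, k) ∈ (G.blowup r).compVerts B C' from H _ hr
  intro y hy
  rw [reachable_iff_reflTransGen] at hy
  induction hy with
  | refl => exact ⟨p.2, hp⟩
  | @tail b c _ hbc ih =>
    obtain ⟨k, hk⟩ := ih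
    have hc : ¬ ∀ i, (c.1, i) ∈ B := fun h => c.2 (hDB h)
    push Not at hc
    obtain ⟨l, hl⟩ := hc
    have hadj : (G.blowup r).Adj (b.1, k) (c.1, l) := hbc
    exact ⟨l, mem_compVerts_of_adj hk hl hadj⟩

theorem ncard_preimage_fst (S : Set V) :
    (Prod.fst ⁻¹' S : Set (V × Fin r)).ncard = r * S.ncard := by
  have : (Prod.fst ⁻¹' S : Set (V × Fin r)) = S ×ˢ (Set.univ : Set (Fin r)) := by
    ext; simp
  rw [this, Set.ncard_prod, Set.ncard_univ, Nat.card_fin, mul_comm]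

/-! ### From three colors to the blowup. -/

variable [Finite V]

/-- A vertex having all its neighbors in the relevant component among the copies of `w` can force
all copies of `w`, in several steps. -/
theorem exists_fill_block {D : Set V} {C : (G.induce Dᶜ).ConnectedComponent} {w : V}
    (hw : w ∈ G.compVerts D C) {a : V × Fin r}
    (ha : ∀ v ∈ G.compVerts D C, G.Adj a.1 v → v = w) (haw : G.Adj a.1 w)
    (B : Set (V × Fin r)) (hDB : D ⊆ fullVerts B) (haB : a ∈ B) :
    ∃ B', B ⊆ B' ∧ w ∈ fullVerts B' ∧
      Relation.ReflTransGen ((G.blowup r).RFoldPSDStep r) B B' := by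
  induction hn : Bᶜ.ncard using Nat.strong_induction_on generalizing B with
  | _ n ih =>
  subst hn
  -- The non-blue copies of `w` may lie in different components, so one force need not fill the
  -- block; each force fills at least one copy.
  by_cases hfull : w ∈ fullVerts B
  · exact ⟨B, subset_rfl, hfull, .refl⟩
  obtain ⟨j, hj⟩ : ∃ j, (w, j) ∉ B := by simpa [fullVerts] using hfull
  set C' := ((G.blowup r).induce Bᶜ).connectedComponentMk ⟨(w, j), hj⟩ with hC'
  have hwj : (w, j) ∈ (G.blowup r).compVerts B C' := mem_compVerts_iff.2 ⟨hj, rfl⟩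
  set N := (G.blowup r).neighborSet a ∩ (G.blowup r).compVerts B C' with hN
  have hsub : N ⊆ Set.range fun i : Fin r => (w, i) := by
    rintro p ⟨hap, hp⟩
    have : p.1 = w := ha _ (fst_mem_compVerts hDB hwj hp hw) hap
    exact ⟨p.2, by rw [← this]⟩
  have hcard : N.ncard ≤ r := by
    refine (Set.ncard_le_ncard hsub (Set.toFinite _)).trans ?_
    rw [← Set.image_univ]
    refine (Set.ncard_image_le (Set.toFinite _)).trans ?_
    simp
  have hwN : (w, j) ∈ N := ⟨haw, hwj⟩
  have hlt : (B ∪ N)ᶜ.ncard < Bᶜ.ncard := by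
    refine Set.ncard_lt_ncard ?_ (Set.toFinite _)
    refine ⟨Set.compl_subset_compl.2 Set.subset_union_left, fun h => h hj (Or.inr hwN)⟩
  obtain ⟨B', h1, h2, h3⟩ := ih _ hlt (B ∪ N)
    (hDB.trans (fullVerts_mono Set.subset_union_left)) (Or.inl haB) rfl
  exact ⟨B', Set.subset_union_left.trans h1, h2, .head ⟨a, haB, C', hcard, rfl⟩ h3⟩

/-- Extra blue copies do no harm: they only shrink components, so containing the prescribed copies
is an invariant. -/
theorem isRFoldPSDForcingSet_of_fracPSD {s : Set V × Set V}
    (hs : Relation.ReflTransGen G.FracPSDStep s (Set.univ, ∅)) (B : Set (V × Fin r))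
    (hD : s.1 ⊆ fullVerts B) (hL : ∀ v ∈ s.2, ∃ i, (v, i) ∈ B) (hr : 0 < r) :
    G.IsRFoldPSDForcingSet r B := by
  induction hs using Relation.ReflTransGen.head_induction_on generalizing B with
  | refl =>
    have : B = Set.univ := Set.eq_univ_of_forall fun p => hD (Set.mem_univ p.1) p.2
    rw [this]
    exact .refl
  | head hstep _ ih =>
    obtain ⟨C, u, w, hu, hw, heq, rfl⟩ := hstep
    have huw : G.Adj u w := (heq.ge rfl).2.1
    obtain ⟨i, hi⟩ : ∃ i, (u, i) ∈ B := by
      rcases hu with hu | hu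
      · exact ⟨⟨0, hr⟩, hD hu _⟩
      · exact hL u hu.1
    have hC : ∀ v ∈ G.compVerts _ C, G.Adj u v → v = w := fun v hv huv =>
      heq.le ⟨Or.inr hv, huv, notMem_of_mem_compVerts hv⟩
    obtain ⟨B', hBB', hwB', hreach⟩ := exists_fill_block (a := (u, i)) hw hC huw B hD hi
    refine hreach.trans (ih B' ?_ ?_)
    · exact Set.insert_subset hwB' (hD.trans (fullVerts_mono hBB'))
    · intro v hv
      obtain ⟨k, hk⟩ := hL v hv.1
      exact ⟨k, hBB' hk⟩

theorem rFoldPSDForcingNumber_le (hr : 0 < r) :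
    G.rFoldPSDForcingNumber r ≤ r * G.threeColorFracPSDForcingNumber + Nat.card V := by
  obtain ⟨D, L, ⟨-, hforce⟩, hcard⟩ := Nat.sInf_mem G.fracPSD_nonempty
  change _ = G.threeColorFracPSDForcingNumber at hcard
  let B : Set (V × Fin r) := Prod.fst ⁻¹' D ∪ (fun v => (v, ⟨0, hr⟩)) '' L
  have hB : G.IsRFoldPSDForcingSet r B :=
    isRFoldPSDForcingSet_of_fracPSD hforce B (fun v hv i => Or.inl hv)
      (fun v hv => ⟨⟨0, hr⟩, Or.inr ⟨v, hv, rfl⟩⟩) hr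
  have hle : G.rFoldPSDForcingNumber r ≤ B.ncard := Nat.sInf_le ⟨B, hB, rfl⟩
  refine hle.trans ((Set.ncard_union_le _ _).trans ?_)
  rw [ncard_preimage_fst, hcard]
  gcongr
  exact (Set.ncard_image_le (Set.toFinite _)).trans (Set.ncard_le_card L)

/-! ### From the blowup to three colors. -/

/-- The copies of the vertices met by an `r`-fold force that are not yet blue number at most
`r`. -/
theorem ncard_blocks_diff_le {B : Set (V × Fin r)} (u : V × Fin r)
    (C : ((G.blowup r).induce Bᶜ).ConnectedComponent)
    (hcard : ((G.blowup r).neighborSet u ∩ (G.blowup r).compVerts B C).ncard ≤ r) :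
    (Prod.fst ⁻¹' (Prod.fst '' ((G.blowup r).neighborSet u ∩ (G.blowup r).compVerts B C)) \
      B).ncard ≤ r := by
  set N := (G.blowup r).neighborSet u ∩ (G.blowup r).compVerts B C with hN
  by_cases hsub : Prod.fst ⁻¹' (Prod.fst '' N) \ B ⊆ (G.blowup r).compVerts B C
  · refine (Set.ncard_le_ncard ?_ (Set.toFinite _)).trans hcard
    rintro p ⟨⟨q, hq, hqp⟩, hpB⟩
    refine ⟨?_, hsub ⟨⟨q, hq, hqp⟩, hpB⟩⟩
    have h1 : G.Adj u.1 q.1 := hq.1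
    change G.Adj u.1 p.1
    rwa [← hqp]
  · obtain ⟨p, ⟨⟨q, hq, hqp⟩, hpB⟩, hpC⟩ := Set.not_subset.1 hsub
    -- A neighbor of `q` inside `C` would also be adjacent to its twin `p` and pull `p` into `C`. So
    -- `q` is alone in `C`, and only one block is met.
    have hone : ∀ x ∈ N, x.1 = q.1 := by
      intro x hx
      by_contra hne
      obtain ⟨z, hz, hqz⟩ := exists_adj_of_mem_compVerts hq.2 hx.2 (fun h => hne (by rw [h]))
      have hzp : (G.blowup r).Adj z p := by
        have h1 : G.Adj q.1 z.1 := hqz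
        change G.Adj z.1 p.1
        rw [← hqp]
        exact h1.symm
      exact hpC (mem_compVerts_of_adj hz hpB hzp)
    calc _ ≤ (Prod.fst ⁻¹' {q.1} : Set (V × Fin r)).ncard := by
          refine Set.ncard_le_ncard ?_ (Set.toFinite _)
          rintro x ⟨⟨y, hy, hyx⟩, -⟩
          exact hyx.symm.trans (hone y hy)
      _ = r := by rw [ncard_preimage_fst, Set.ncard_singleton, mul_one]

/-- Every superset of an `r`-fold PSD forcing set yields a fractional PSD forcing set in which all
vertices are dark blue or light blue. -/
theorem exists_fracPSD_of_isRFoldPSDForcingSet {B : Set (V × Fin r)}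
    (hB : G.IsRFoldPSDForcingSet r B) (A : Set (V × Fin r)) (hBA : B ⊆ A) :
    ∃ D : Set V, fullVerts A ⊆ D ∧ r * D.ncard ≤ A.ncard ∧
      Relation.ReflTransGen G.FracPSDStep (D, Dᶜ) (Set.univ, ∅) := by
  induction hB using Relation.ReflTransGen.head_induction_on generalizing A with
  | refl =>
    refine ⟨Set.univ, Set.subset_univ _, ?_, by rw [Set.compl_univ]⟩
    rw [Set.univ_subset_iff.1 hBA, Set.ncard_univ, Set.ncard_univ, Nat.card_prod, Nat.card_fin,
      mul_comm]
  | @head B _ hstep _ ih =>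
    obtain ⟨u, huB, C, hcard, rfl⟩ := hstep
    have hblocks := ncard_blocks_diff_le u C hcard
    set N := (G.blowup r).neighborSet u ∩ (G.blowup r).compVerts B C with hN
    set M : Set (V × Fin r) := Prod.fst ⁻¹' (Prod.fst '' N) with hM
    have hNM : N ⊆ M := Set.subset_preimage_image _ _
    by_cases hMA : M ⊆ A
    · exact ih A (Set.union_subset hBA (hNM.trans hMA))
    obtain ⟨p, hpM, hpA⟩ := Set.not_subset.1 hMA
    obtain ⟨q, hq, hqp⟩ := hpM
    -- Adding whole blocks puts every vertex met by `N` into `D'`. Deleting `q.1` then saves `r`,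
    -- which offsets the at most `r` added elements.
    obtain ⟨D', hfull, hle, hforce⟩ := ih (A ∪ M) (Set.union_subset_union hBA hNM)
    have hND' : ∀ x ∈ N, x.1 ∈ D' := fun x hx => hfull fun i => Or.inr ⟨x, hx, rfl⟩
    have hqD' := hND' q hq
    have hAD : fullVerts A ⊆ D' \ {q.1} := by
      refine fun v hv => ⟨hfull (fullVerts_mono Set.subset_union_left hv), ?_⟩
      rintro rfl
      exact hpA (by simpa [hqp] using hv p.2)
    refine ⟨D' \ {q.1}, hAD, ?_, .head ?_ hforce⟩
    · have h1 : (A ∪ M).ncard ≤ A.ncard + r := by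
        rw [← Set.union_sdiff_self]
        refine (Set.ncard_union_le _ _).trans ?_
        gcongr
        exact (Set.ncard_le_ncard (Set.sdiff_subset_sdiff_right hBA) (Set.toFinite _)).trans hblocks
      have h2 := Set.ncard_sdiff_singleton_add_one hqD' (Set.toFinite _)
      rw [← h2, mul_add, mul_one] at hle
      omega
    · set D := D' \ {q.1} with hD
      have hqD : q.1 ∈ Dᶜ := fun h => h.2 rfl
      have huq : G.Adj u.1 q.1 := hq.1
      have hqC : q.1 ∈ G.compVerts D ((G.induce Dᶜ).connectedComponentMk ⟨q.1, hqD⟩) :=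
        mem_compVerts_iff.2 ⟨hqD, rfl⟩
      refine ⟨(G.induce Dᶜ).connectedComponentMk ⟨q.1, hqD⟩, u.1, q.1, ?_, hqC, ?_, ?_⟩
      · by_cases huD : u.1 ∈ D
        · exact Or.inl huD
        · exact Or.inr ⟨huD, mem_compVerts_of_adj hqC huD huq.symm⟩
      · ext v
        constructor
        · rintro ⟨hv, huv, hvD⟩
          have hvC := hv.resolve_left hvD
          -- The component of `q.1` lifts into `C`, so `v` has a copy in `N` and lies in `D'`; only
          -- `q.1` was deleted from `D'`.
          obtain ⟨k, hk⟩ := exists_mem_compVerts_blowup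
            ((fullVerts_mono hBA).trans hAD) hq.2 hqC hvC
          by_contra hne
          exact hvD ⟨hND' (v, k) ⟨huv, hk⟩, hne⟩
        · rintro rfl
          exact ⟨Or.inr hqC, huq, hqD⟩
      · have h1 : insert q.1 D = D' := by
          rw [hD, Set.insert_sdiff_singleton, Set.insert_eq_of_mem hqD']
        refine Prod.ext h1.symm ?_
        change D'ᶜ = Dᶜ \ {q.1}
        rw [← h1]
        ext x
        simp [not_or, and_comm]

theorem mul_threeColorFracPSDForcingNumber_le :
    r * G.threeColorFracPSDForcingNumber ≤ G.rFoldPSDForcingNumber r := by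
  obtain ⟨B, hB, hcard⟩ := Nat.sInf_mem (G.rFoldPSD_nonempty r)
  change _ = G.rFoldPSDForcingNumber r at hcard
  obtain ⟨D, -, hle, hforce⟩ := exists_fracPSD_of_isRFoldPSDForcingSet hB B subset_rfl
  rw [← hcard]
  refine le_trans ?_ hle
  gcongr
  exact Nat.sInf_le ⟨D, Dᶜ, ⟨disjoint_compl_right, hforce⟩, rfl⟩

end Blowup

end SimpleGraph

theorem mainTheorem1 {V : Type*} [Finite V] (G : SimpleGraph V) :
    G.fractionalPSDForcingNumber = (G.threeColorFracPSDForcingNumber : ℝ) := by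
  unfold SimpleGraph.fractionalPSDForcingNumber
  have hbdd : BddBelow (Set.range fun r : ℕ+ =>
      (G.rFoldPSDForcingNumber (r : ℕ) : ℝ) / ((r : ℕ) : ℝ)) :=
    ⟨0, by rintro _ ⟨r, rfl⟩; positivity⟩
  apply le_antisymm
  · refine le_of_forall_pos_le_add fun ε hε => ?_
    obtain ⟨n, hn⟩ := exists_nat_gt ((Nat.card V : ℝ) / ε)
    have hn0 : (0 : ℝ) < n := lt_of_le_of_lt (by positivity) hn
    have hn0' : 0 < n := by exact_mod_cast hn0
    refine (ciInf_le hbdd ⟨n, hn0'⟩).trans ?_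
    have h : (G.rFoldPSDForcingNumber n : ℝ) ≤
        n * G.threeColorFracPSDForcingNumber + Nat.card V := by
      exact_mod_cast G.rFoldPSDForcingNumber_le hn0'
    rw [div_lt_iff₀ hε] at hn
    simp only [PNat.mk_coe]
    rw [div_le_iff₀ hn0]
    linarith
  · refine le_ciInf fun r => ?_
    rw [le_div_iff₀ (by exact_mod_cast r.pos), mul_comm]
    exact_mod_cast G.mul_threeColorFracPSDForcingNumber_le
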